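/- Let $\mathcal O$ be a Dedekind domain, $\pi\in\mathcal O$ a generator of a nonzero prime ideal with finite residue field $\mathcal O/(\pi)$ of cardinality $q$. For an $\mathcal O$-algebra $B$ let $W_n(B)$ be the ring of truncated $\pi$-typical Witt vectors: as a set $W_n(B)=B^{n+1}$, with the unique $\mathcal O$-algebra structure, functorial in $B$, for which the ghost components $w_i=x_0^{q^i}+\pi x_1^{q^{i-1}}+\dots+\pi^i x_i$ ($0\le i\le n$) are homomorphisms of $\mathcal O$-algebras. Let $R_*$ be a prolongation sequence over $\mathcal O$: a sequence of $\mathcal O$-algebras $R_0,R_1,\dots$ with $\mathcal O$-algebra homomorphisms $u_m\colon R_m\to R_{m+1}$ and maps $\delta_m\colon R_m\to R_{m+1}$ such that, for all $m$ and $x,y$, $$\delta_m(x+y)=\delta_m x+\delta_m y+C_\pi(u_m x,u_m y),\qquad \delta_m(xy)=u_m(x)^q\delta_m y+u_m(y)^q\delta_m x+\pi\,\delta_m x\,\delta_m y,$$ where $C_\pi(X,Y)=\frac{X^q+Y^q-(X+Y)^q}{\pi}\in\mathcal O[X,Y]$, such that $u_{m+1}\delta_m=\delta_{m+1}u_m$,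 and such that for $a\in\mathcal O$ the map $\delta_m$ sends the image of $a$ to the image of $\pi^{-1}(a-a^q)$. Let $P_0,P_1,\dots\in\mathcal O[T,T',T'',\dots]$ be the polynomials with $w_i(P_0,\dots,P_i)=\phi^i(T)$ for all $i$, where $\phi$ is the $\mathcal O$-algebra endomorphism with $\phi(T^{(j)})=(T^{(j)})^q+\pi T^{(j+1)}$; then $P_i\in\mathcal O[T,\dots,T^{(i)}]$. The map $R_0\to W_n(R_n)$, $c\mapsto (P_0(c),\dots,P_n(c))$, where $P_i(c)$ is the value of $P_i$ at the images in $R_n$ of $c,\delta c,\dots,\delta^i c$, is a homomorphism of $\mathcal O$-algebras; composing it with $W_n(R_n)\to W_n(B)$ makes $W_n(B)$ an $R_0$-algebra for every $R_n$-algebra $B$. For an $R_0$-scheme $X$ let $J^nX$ be the functor on $R_n$-algebras given by $J^nX(B)=X(W_n(B))=\mathrm{Hom}_{R_0}(\operatorname{Spec}W_n(B),X)$, and for a morphism $f$ of $R_0$-schemes let $J^nf$ be the induced map. Let $n\ge 0$ and let $f\colon X\to Y$ be a closed immersion of $R_0$-schemes. Then $J^nf\colon J^nX\to J^nY$ is a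 closed immersion of sheaves over $R_n$: for every $R_n$-scheme $T$ and every map $T\to J^nY$ (of functors on $R_n$-algebras), the base change $J^nX\times_{J^nY}T\to T$ is a closed immersion of schemes. -/

import Mathlib

open CategoryTheory AlgebraicGeometry

set_option linter.unusedSectionVars false
set_option linter.unusedSimpArgs false

universe u v w

noncomputable section

namespace PiJet

section Basic

variable {O : Type v} [CommRing O]

/-- The cardinality `q` of the residue field `O / (π)`. -/
def resCard (π : O) : ℕ := Nat.card (O ⧸ Ideal.span {π})

/-- The quotient `a / b` in a commutative ring, for `b ∣ a` (and `0` otherwise).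
It is only used for `b` a nonzero element of a domain, where the quotient is unique. -/
def exactDiv {A : Type w} [CommRing A] (a b : A) : A :=
  open Classical in if h : b ∣ a then h.choose else 0

theorem mul_exactDiv {A : Type w} [CommRing A] {a b : A} (h : b ∣ a) :
    b * exactDiv a b = a := by
  rw [exactDiv, dif_pos h]
  exact h.choose_spec.symm

/-- The polynomial `C_π(X, Y) = (X ^ q + Y ^ q - (X + Y) ^ q) / π` over `O`. -/
def Cpi (π : O) : MvPolynomial (Fin 2) O :=
  exactDiv (MvPolynomial.X 0 ^ resCard π + MvPolynomial.X 1 ^ resCard π -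
    (MvPolynomial.X 0 + MvPolynomial.X 1) ^ resCard π) (MvPolynomial.C π)

/-- `δ` is a `π`-derivation relative to the homomorphism of `O`-algebras `u`. -/
structure IsPiDerivation (π : O) {A B : Type*} [CommRing A] [CommRing B] [Algebra O A]
    [Algebra O B] (u : A →ₐ[O] B) (δ : A → B) : Prop where
  add : ∀ x y, δ (x + y) = δ x + δ y + MvPolynomial.aeval ![u x, u y] (Cpi π)
  mul : ∀ x y, δ (x * y) = u x ^ resCard π * δ y + u y ^ resCard π * δ x +
    algebraMap O B π * δ x * δ y

/-- The `π`-derivation `a ↦ (a - a ^ q) / π` of `O`. -/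
def baseDelta (π a : O) : O := exactDiv (a - a ^ resCard π) π

/-- A prolongation sequence of `O`-algebras `C 0 → C 1 → C 2 → ⋯` lying over the constant
prolongation sequence `(O, id, baseDelta π)`. -/
structure ProlongationSequence (π : O) where
  /-- the terms of the sequence -/
  C : ℕ → Type u
  [commRing : ∀ n, CommRing (C n)]
  [algebra : ∀ n, Algebra O (C n)]
  /-- the transition homomorphisms -/
  u : ∀ n, C n →ₐ[O] C (n + 1)
  /-- the `π`-derivations -/
  δ : ∀ n, C n → C (n + 1)
  isPiDerivation : ∀ n, IsPiDerivation π (u n) (δ n)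
  u_δ : ∀ n x, u (n + 1) (δ n x) = δ (n + 1) (u n x)
  /-- the structure maps `O → C n` form a morphism of prolongation sequences -/
  δ_algebraMap : ∀ n a, δ n (algebraMap O (C n) a) = algebraMap O (C (n + 1)) (baseDelta π a)

attribute [instance] ProlongationSequence.commRing ProlongationSequence.algebra

/-- The `i`-th ghost polynomial `x₀ ^ (q ^ i) + π x₁ ^ (q ^ (i - 1)) + ⋯ + π ^ i xᵢ`,
evaluated at the sequence `x`. -/
def ghost (π : O) {B : Type w} [CommRing B] [Algebra O B] (x : ℕ → B) (i : ℕ) : B :=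
  ∑ j ∈ Finset.range (i + 1), algebraMap O B π ^ j * x j ^ resCard π ^ (i - j)

/-- The sequence `x` with ghost components `a`, in an `O`-algebra without `π`-torsion, for `a` in
the image of the ghost map. -/
def unghost (π : O) {A : Type w} [CommRing A] [Algebra O A] (a : ℕ → A) (i : ℕ) : A :=
  exactDiv (a i - ∑ j : Fin i, algebraMap O A π ^ (j : ℕ) *
    unghost π a j ^ resCard π ^ (i - (j : ℕ))) (algebraMap O A π ^ i)
termination_by i
decreasing_by exact j.2

/-- The Witt structure polynomials `S₀, S₁, …` of an operation `Φ`: they are determined by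
`wᵢ(S₀, S₁, …) = Φ(wᵢ(X₀), wᵢ(X₁), …)` for all `i`, with `wᵢ` the ghost polynomials. -/
def structPoly (π : O) {ι : Type} (Φ : MvPolynomial ι O) (i : ℕ) : MvPolynomial (ι × ℕ) O :=
  unghost π (fun i ↦ MvPolynomial.aeval
    (fun b ↦ ghost π (fun j ↦ (MvPolynomial.X (b, j) : MvPolynomial (ι × ℕ) O)) i) Φ) i

/-- The endomorphism `T⁽ⁱ⁾ ↦ (T⁽ⁱ⁾) ^ q + π T⁽ⁱ⁺¹⁾` of `O[T, T', T'', …]`, or the same in several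
families of variables indexed by `S`. -/
def phi (π : O) (S : Type w) :
    MvPolynomial (S × ℕ) O →ₐ[O] MvPolynomial (S × ℕ) O :=
  MvPolynomial.aeval (fun s ↦ MvPolynomial.X s ^ resCard π +
    MvPolynomial.C π * MvPolynomial.X (s.1, s.2 + 1))

/-- The polynomials `P₀, P₁, …` in `O[T, T', T'', …]` that express the coordinates of the
exponential map `b ↦ (P₀(b), P₁(b), …)` of an `O`-algebra with `π`-derivation through
`b, δ b, δ² b, …`. They are determined by `wᵢ(P₀, P₁, …) = φⁱ(T)` for all `i`. -/
def expPoly (π : O) (i : ℕ) : MvPolynomial (Unit × ℕ) O :=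
  unghost π (fun i ↦ (phi π Unit)^[i] (MvPolynomial.X ((), 0))) i

/-- The set `W_n(B) = B ^ (n + 1)` of truncated `π`-typical Witt vectors
(indexed so that `W_0(B) = B`). -/
@[ext]
structure Witt (π : O) (n : ℕ) (B : Type w) where
  /-- the components -/
  coeff : Fin (n + 1) → B

end Basic

/-! ### Arithmetic of ghost components -/

section Ghost

variable {O : Type v} [CommRing O] (π : O)

theorem ghost_succ {B : Type w} [CommRing B] [Algebra O B] (x : ℕ → B) (i : ℕ) :
    ghost π x i = (∑ j : Fin i, algebraMap O B π ^ (j : ℕ) *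
      x j ^ resCard π ^ (i - (j : ℕ))) + algebraMap O B π ^ i * x i := by
  rw [ghost, Finset.sum_range_succ, Nat.sub_self, pow_zero, pow_one,
    Finset.sum_range (fun j ↦ algebraMap O B π ^ j * x j ^ resCard π ^ (i - j))]

theorem map_ghost {B B' : Type*} [CommRing B] [Algebra O B] [CommRing B'] [Algebra O B']
    (f : B →ₐ[O] B') (x : ℕ → B) (i : ℕ) :
    f (ghost π x i) = ghost π (fun j ↦ f (x j)) i := by
  simp [ghost, map_sum]

theorem ghost_congr {B : Type w} [CommRing B] [Algebra O B] {x y : ℕ → B} {i : ℕ}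
    (h : ∀ j ≤ i, x j = y j) : ghost π x i = ghost π y i :=
  Finset.sum_congr rfl fun j hj ↦ by rw [h j (by simpa [Nat.lt_succ_iff] using hj)]

variable [IsDomain O] [hπ : Fact (Prime π)] [Finite (O ⧸ Ideal.span {π})]

theorem C_ne_zero (σ : Type w) : (MvPolynomial.C π : MvPolynomial σ O) ≠ 0 := by
  simpa using hπ.out.ne_zero

theorem ghost_inj {σ : Type w} {x y : ℕ → MvPolynomial σ O} {n : ℕ}
    (h : ∀ i ≤ n, ghost π x i = ghost π y i) : ∀ i ≤ n, x i = y i := by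
  intro i
  induction i using Nat.strong_induction_on with
  | _ i ih =>
    intro hi
    have := h i hi
    rw [ghost_succ, ghost_succ, Finset.sum_congr rfl (fun j _ ↦ by
      rw [ih j j.2 (by omega)])] at this
    exact mul_left_cancel₀ (pow_ne_zero i (C_ne_zero π σ)) (add_left_cancel this)

theorem isMaximal : (Ideal.span {π} : Ideal O).IsMaximal := by
  have : (Ideal.span {π} : Ideal O).IsPrime :=
    (Ideal.span_singleton_prime hπ.out.ne_zero).2 hπ.out
  exact Ideal.Quotient.maximal_of_isField _ (Finite.isField_of_domain _)

/-- Any endomorphism that lifts the `q`-Frobenius on the variables lifts it everywhere. -/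
theorem dvd_sub_frob {σ : Type w} (φ : MvPolynomial σ O →ₐ[O] MvPolynomial σ O)
    (h : ∀ s, MvPolynomial.C π ∣
      φ (MvPolynomial.X s) - MvPolynomial.X s ^ resCard π) (a : MvPolynomial σ O) :
    MvPolynomial.C π ∣ φ a - a ^ resCard π := by
  have hm := isMaximal π
  let I : Ideal O := Ideal.span {π}
  let _ : Field (O ⧸ I) := Ideal.Quotient.field I
  let _ : Fintype (O ⧸ I) := Fintype.ofFinite _
  let r : MvPolynomial σ O →ₐ[O] MvPolynomial σ (O ⧸ I) :=
    MvPolynomial.mapAlgHom (Algebra.ofId O (O ⧸ I))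
  have hr : ∀ x, r x = MvPolynomial.map (Ideal.Quotient.mk I) x := fun _ ↦ rfl
  have key : ∀ x, MvPolynomial.C π ∣ x ↔ r x = 0 := by
    intro x
    rw [MvPolynomial.C_dvd_iff_dvd_coeff, hr, MvPolynomial.ext_iff]
    simp only [MvPolynomial.coeff_map, MvPolynomial.coeff_zero, Ideal.Quotient.eq_zero_iff_mem, I,
      Ideal.mem_span_singleton]
  let F : MvPolynomial σ (O ⧸ I) →ₐ[O] MvPolynomial σ (O ⧸ I) :=
    (FiniteField.frobeniusAlgHom (O ⧸ I) _).restrictScalars O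
  have hF : ∀ x, F x = x ^ resCard π := by
    intro x
    change x ^ Fintype.card (O ⧸ I) = _
    rw [resCard, Nat.card_eq_fintype_card]
  have : r.comp φ = F.comp r := by
    apply MvPolynomial.algHom_ext
    intro s
    have := (key _).1 (h s)
    rw [map_sub, sub_eq_zero, map_pow] at this
    simp only [AlgHom.comp_apply, this, hF]
  rw [key, map_sub, sub_eq_zero, map_pow, ← hF]
  exact DFunLike.congr_fun this a

theorem C_dvd_card (σ : Type w) : (MvPolynomial.C π : MvPolynomial σ O) ∣ (resCard π : ℕ) := by
  have : π ∣ (resCard π : ℕ) := by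
    rw [← Ideal.mem_span_singleton, ← Ideal.Quotient.eq_zero_iff_mem, map_natCast]
    let _ : Fintype (O ⧸ Ideal.span {π}) := Fintype.ofFinite _
    rw [resCard, Nat.card_eq_fintype_card]
    exact Nat.cast_card_eq_zero _
  simpa using map_dvd (MvPolynomial.C (σ := σ)) this

theorem resCard_pos : 0 < resCard π := Nat.card_pos

theorem dvd_pow_sub {σ : Type w} {a b : MvPolynomial σ O}
    (h : MvPolynomial.C π ∣ a - b) (k : ℕ) :
    MvPolynomial.C π ^ (k + 1) ∣ a ^ resCard π ^ k - b ^ resCard π ^ k := by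
  induction k with
  | zero => simpa using h
  | succ k ih =>
    set a' := a ^ resCard π ^ k
    set b' := b ^ resCard π ^ k
    have hab : MvPolynomial.C π ∣ a' - b' := (dvd_pow_self _ (by omega)).trans ih
    rw [pow_succ (resCard π), pow_mul, pow_mul, pow_succ (MvPolynomial.C π),
      ← (Commute.all a' b').geom_sum₂_mul, mul_comm]
    refine mul_dvd_mul ?_ ih
    rw [← Ideal.mem_span_singleton, ← Ideal.Quotient.eq_zero_iff_mem] at hab ⊢
    rw [map_sub, sub_eq_zero] at hab
    rw [map_sum]
    have h1 : ∀ i ∈ Finset.range (resCard π),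
        Ideal.Quotient.mk (Ideal.span {(MvPolynomial.C π : MvPolynomial σ O)})
          (a' ^ i * b' ^ (resCard π - 1 - i)) =
        Ideal.Quotient.mk _ (b' ^ (resCard π - 1)) := by
      intro i hi
      rw [map_mul, map_pow, hab, ← map_pow, ← map_mul, ← pow_add]
      congr 2
      have := Finset.mem_range.1 hi
      omega
    rw [Finset.sum_congr rfl h1, Finset.sum_const, Finset.card_range, nsmul_eq_mul,
      ← map_natCast (Ideal.Quotient.mk _), ← map_mul, Ideal.Quotient.eq_zero_iff_mem,
      Ideal.mem_span_singleton]
    exact (C_dvd_card π σ).mul_right _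

theorem dvd_ghost_sub {σ : Type w} (φ : MvPolynomial σ O →ₐ[O] MvPolynomial σ O)
    (h : ∀ s, MvPolynomial.C π ∣ φ (MvPolynomial.X s) - MvPolynomial.X s ^ resCard π)
    (x : ℕ → MvPolynomial σ O) (i : ℕ) :
    MvPolynomial.C π ^ (i + 1) ∣ (∑ j : Fin (i + 1), MvPolynomial.C π ^ (j : ℕ) *
      x j ^ resCard π ^ (i + 1 - (j : ℕ))) - φ (ghost π x i) := by
  rw [map_ghost, ghost, ← Finset.sum_range (fun j ↦ MvPolynomial.C π ^ (j : ℕ) *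
      x j ^ resCard π ^ (i + 1 - (j : ℕ))), ← Finset.sum_sub_distrib]
  refine Finset.dvd_sum fun j hj ↦ ?_
  have hj' := Finset.mem_range.1 hj
  rw [MvPolynomial.algebraMap_eq, ← mul_sub]
  have h2 := dvd_pow_sub π (dvd_sub_comm.1 (dvd_sub_frob π φ h (x j))) (i - j)
  rw [← pow_mul, ← pow_succ'] at h2
  have e1 : i + 1 = j + (i - j + 1) := by omega
  have e2 : i + 1 - j = i - j + 1 := by omega
  rw [e2]
  conv_lhs => rw [e1, pow_add]
  exact mul_dvd_mul_left _ h2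

/-- Dwork's criterion. -/
theorem ghost_unghost {σ : Type w} (φ : MvPolynomial σ O →ₐ[O] MvPolynomial σ O)
    (h : ∀ s, MvPolynomial.C π ∣ φ (MvPolynomial.X s) - MvPolynomial.X s ^ resCard π)
    (a : ℕ → MvPolynomial σ O)
    (ha : ∀ i, MvPolynomial.C π ^ (i + 1) ∣ a (i + 1) - φ (a i)) (i : ℕ) :
    ghost π (unghost π a) i = a i := by
  have step : ∀ i, MvPolynomial.C π ^ i ∣ a i - ∑ j : Fin i, MvPolynomial.C π ^ (j : ℕ) *
      unghost π a j ^ resCard π ^ (i - (j : ℕ)) → ghost π (unghost π a) i = a i := by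
    intro i hi
    have := mul_exactDiv hi
    rw [ghost_succ]
    conv_lhs => enter [2, 2]; rw [unghost]
    rw [MvPolynomial.algebraMap_eq, this]
    ring
  induction i with
  | zero => exact step 0 (by simp)
  | succ i ih =>
    apply step
    have h1 := dvd_ghost_sub π φ h (unghost π a) i
    rw [ih] at h1
    have := dvd_sub (ha i) h1
    rwa [sub_sub_sub_cancel_right] at this

theorem Cpi_spec : MvPolynomial.C π * Cpi π = MvPolynomial.X 0 ^ resCard π +
    MvPolynomial.X 1 ^ resCard π - (MvPolynomial.X 0 + MvPolynomial.X 1) ^ resCard π := by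
  apply mul_exactDiv
  have := dvd_sub_frob π (MvPolynomial.aeval
    (fun s : Fin 2 ↦ (MvPolynomial.X s ^ resCard π : MvPolynomial (Fin 2) O))) (by simp)
    (MvPolynomial.X 0 + MvPolynomial.X 1)
  simpa using this

theorem baseDelta_spec (a : O) : π * baseDelta π a = a - a ^ resCard π := by
  apply mul_exactDiv
  have := dvd_sub_frob π (AlgHom.id O (MvPolynomial Empty O)) (fun s ↦ s.elim)
    (MvPolynomial.C a)
  rw [AlgHom.id_apply, ← map_pow, ← map_sub, MvPolynomial.C_dvd_iff_dvd_coeff] at this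
  have h0 := this 0
  rwa [MvPolynomial.coeff_zero_C] at h0

theorem ghost_structPoly {ι : Type} (Φ : MvPolynomial ι O) (i : ℕ) :
    ghost π (structPoly π Φ) i = MvPolynomial.aeval
      (fun b ↦ ghost π (fun j ↦ (MvPolynomial.X (b, j) : MvPolynomial (ι × ℕ) O)) i) Φ := by
  let φ : MvPolynomial (ι × ℕ) O →ₐ[O] MvPolynomial (ι × ℕ) O :=
    MvPolynomial.aeval (fun s ↦ MvPolynomial.X s ^ resCard π)
  have hφ : ∀ s, MvPolynomial.C π ∣ φ (MvPolynomial.X s) - MvPolynomial.X s ^ resCard π := by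
    simp [φ]
  refine ghost_unghost π φ hφ _ (fun i ↦ ?_) i
  rw [← Ideal.mem_span_singleton, ← Ideal.Quotient.eq_zero_iff_mem, map_sub, sub_eq_zero]
  let m : MvPolynomial (ι × ℕ) O →ₐ[O] _ := Ideal.Quotient.mkₐ O
    (Ideal.span {(MvPolynomial.C π ^ (i + 1) : MvPolynomial (ι × ℕ) O)})
  change m _ = m (φ _)
  rw [MvPolynomial.comp_aeval_apply _ φ, MvPolynomial.comp_aeval_apply _ m,
    MvPolynomial.comp_aeval_apply _ m]
  have : ∀ b, m (ghost π (fun j ↦ (MvPolynomial.X (b, j))) (i + 1)) =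
      m (φ (ghost π (fun j ↦ (MvPolynomial.X (b, j))) i)) := by
    intro b
    have h1 := dvd_ghost_sub π φ hφ (fun j ↦ (MvPolynomial.X (b, j))) i
    have h2 : MvPolynomial.C π ^ (i + 1) ∣ ghost π (fun j ↦ (MvPolynomial.X (b, j))) (i + 1) -
        φ (ghost π (fun j ↦ (MvPolynomial.X (b, j))) i) := by
      rw [ghost_succ, add_sub_right_comm]
      exact dvd_add h1 (Dvd.intro _ rfl)
    rw [← sub_eq_zero, ← map_sub]
    exact Ideal.Quotient.eq_zero_iff_mem.2 (Ideal.mem_span_singleton.2 h2)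
  simp only [this]

theorem phi_frob (S : Type w) (s : S × ℕ) : MvPolynomial.C π ∣
    phi π S (MvPolynomial.X s) - MvPolynomial.X s ^ resCard π := by
  simp [phi]

theorem ghost_expPoly (i : ℕ) :
    ghost π (expPoly π) i = (phi π Unit)^[i] (MvPolynomial.X ((), 0)) :=
  ghost_unghost π (phi π Unit) (phi_frob π Unit) _
    (fun i ↦ by simp [Function.iterate_succ_apply']) i

end Ghost

/-! ### The ring structure on Witt vectors -/

namespace Witt

variable {O : Type v} [CommRing O] {π : O} {n : ℕ}

/-- The components of a truncated Witt vector, extended by `0`. -/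
def get {B : Type w} [CommRing B] (x : Witt π n B) (j : ℕ) : B :=
  if h : j < n + 1 then x.coeff ⟨j, h⟩ else 0

/-- The `i`-th ghost component of a Witt vector, for `i ≤ n`. -/
def gh {B : Type w} [CommRing B] [Algebra O B] (x : Witt π n B) (i : ℕ) : B := ghost π x.get i

/-- The operation on Witt vectors that is `Φ` on ghost components, functorially in `B`. -/
def op {ι : Type} (Φ : MvPolynomial ι O) {B : Type w} [CommRing B] [Algebra O B]
    (x : ι → Witt π n B) : Witt π n B where
  coeff i := MvPolynomial.aeval (fun s ↦ (x s.1).get s.2) (structPoly π Φ i)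

/-- The map `W_n(f)`, on sets. -/
def mapFun {B B' : Type*} (f : B → B') (x : Witt π n B) : Witt π n B' where
  coeff i := f (x.coeff i)

section

variable {B : Type w} [CommRing B] [Algebra O B]

instance : Zero (Witt π n B) := ⟨op (0 : MvPolynomial Empty O) Empty.elim⟩
instance : One (Witt π n B) := ⟨op (1 : MvPolynomial Empty O) Empty.elim⟩
instance : Neg (Witt π n B) := ⟨fun x ↦ op (-MvPolynomial.X 0 : MvPolynomial (Fin 1) O) ![x]⟩
instance : Add (Witt π n B) :=
  ⟨fun x y ↦ op (MvPolynomial.X 0 + MvPolynomial.X 1 : MvPolynomial (Fin 2) O) ![x, y]⟩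
instance : Mul (Witt π n B) :=
  ⟨fun x y ↦ op (MvPolynomial.X 0 * MvPolynomial.X 1 : MvPolynomial (Fin 2) O) ![x, y]⟩

/-- The image of an element of `O`. -/
def const (a : O) : Witt π n B := op (MvPolynomial.C a : MvPolynomial Empty O) Empty.elim

theorem zero_def : (0 : Witt π n B) = op (0 : MvPolynomial Empty O) Empty.elim := rfl
theorem one_def : (1 : Witt π n B) = op (1 : MvPolynomial Empty O) Empty.elim := rfl
theorem neg_def (x : Witt π n B) :
    -x = op (-MvPolynomial.X 0 : MvPolynomial (Fin 1) O) ![x] := rfl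
theorem add_def (x y : Witt π n B) :
    x + y = op (MvPolynomial.X 0 + MvPolynomial.X 1 : MvPolynomial (Fin 2) O) ![x, y] := rfl
theorem mul_def (x y : Witt π n B) :
    x * y = op (MvPolynomial.X 0 * MvPolynomial.X 1 : MvPolynomial (Fin 2) O) ![x, y] := rfl

theorem get_of_le (x : Witt π n B) {i : ℕ} (hi : i ≤ n) :
    x.get i = x.coeff ⟨i, Nat.lt_succ_of_le hi⟩ := dif_pos _

end

section

variable {B B' : Type*} [CommRing B] [Algebra O B] [CommRing B'] [Algebra O B'] (f : B →ₐ[O] B')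

theorem get_mapFun (x : Witt π n B) (i : ℕ) : (mapFun f x).get i = f (x.get i) := by
  unfold get
  split <;> simp [mapFun]

theorem mapFun_op {ι : Type} (Φ : MvPolynomial ι O) (x : ι → Witt π n B) :
    mapFun f (op Φ x) = op Φ (fun b ↦ mapFun f (x b)) := by
  ext i
  simp only [mapFun, op, MvPolynomial.comp_aeval_apply]
  congr 2
  ext s
  exact (get_mapFun f _ _).symm

theorem mapFun_op_empty (Φ : MvPolynomial Empty O) :
    mapFun f (op Φ Empty.elim : Witt π n B) = op Φ Empty.elim := by
  rw [mapFun_op]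
  congr 1
  ext s
  exact s.elim

theorem mapFun_zero : mapFun f (0 : Witt π n B) = 0 := mapFun_op_empty f _
theorem mapFun_one : mapFun f (1 : Witt π n B) = 1 := mapFun_op_empty f _
theorem mapFun_const (a : O) : mapFun f (const a : Witt π n B) = const a := mapFun_op_empty f _

theorem mapFun_neg (x : Witt π n B) : mapFun f (-x) = -mapFun f x := by
  rw [neg_def, mapFun_op, neg_def]
  congr 1
  funext b
  fin_cases b
  rfl

theorem mapFun_add (x y : Witt π n B) : mapFun f (x + y) = mapFun f x + mapFun f y := by
  rw [add_def, mapFun_op, add_def]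
  congr 1
  funext b
  fin_cases b <;> rfl

theorem mapFun_mul (x y : Witt π n B) : mapFun f (x * y) = mapFun f x * mapFun f y := by
  rw [mul_def, mapFun_op, mul_def]
  congr 1
  funext b
  fin_cases b <;> rfl

end

section

variable [IsDomain O] [hπ : Fact (Prime π)] [Finite (O ⧸ Ideal.span {π})]
variable {B : Type w} [CommRing B] [Algebra O B]

theorem gh_op {ι : Type} (Φ : MvPolynomial ι O) (x : ι → Witt π n B) {i : ℕ} (hi : i ≤ n) :
    (op Φ x).gh i = MvPolynomial.aeval (fun b ↦ (x b).gh i) Φ := by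
  have h1 : (op Φ x).gh i = ghost π (fun j ↦
      MvPolynomial.aeval (fun s : ι × ℕ ↦ (x s.1).get s.2) (structPoly π Φ j)) i :=
    ghost_congr π fun j hj ↦ get_of_le _ (hj.trans hi)
  have h2 := congrArg (MvPolynomial.aeval (fun s : ι × ℕ ↦ (x s.1).get s.2))
    (ghost_structPoly π Φ i)
  rw [map_ghost, MvPolynomial.comp_aeval_apply] at h2
  rw [h1, h2]
  congr 2
  funext b
  rw [map_ghost]
  simp [gh]

theorem gh_zero {i : ℕ} (hi : i ≤ n) : (0 : Witt π n B).gh i = 0 := by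
  rw [zero_def, gh_op _ _ hi, map_zero]
theorem gh_one {i : ℕ} (hi : i ≤ n) : (1 : Witt π n B).gh i = 1 := by
  rw [one_def, gh_op _ _ hi, map_one]
theorem gh_const (a : O) {i : ℕ} (hi : i ≤ n) :
    (const a : Witt π n B).gh i = algebraMap O B a := by
  rw [const, gh_op _ _ hi, MvPolynomial.aeval_C]
theorem gh_neg (x : Witt π n B) {i : ℕ} (hi : i ≤ n) : (-x).gh i = -x.gh i := by
  rw [neg_def, gh_op _ _ hi]; simp
theorem gh_add (x y : Witt π n B) {i : ℕ} (hi : i ≤ n) : (x + y).gh i = x.gh i + y.gh i := by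
  rw [add_def, gh_op _ _ hi]; simp
theorem gh_mul (x y : Witt π n B) {i : ℕ} (hi : i ≤ n) : (x * y).gh i = x.gh i * y.gh i := by
  rw [mul_def, gh_op _ _ hi]; simp

theorem gh_ext {σ : Type w} {x y : Witt π n (MvPolynomial σ O)}
    (h : ∀ i ≤ n, x.gh i = y.gh i) : x = y := by
  ext i : 2
  have hi : (i : ℕ) ≤ n := Nat.le_of_lt_succ i.2
  have := ghost_inj π h i hi
  rwa [get_of_le _ hi, get_of_le _ hi] at this

theorem exists_lift (x : Witt π n B) : ∃ y : Witt π n (MvPolynomial B O),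
    mapFun (MvPolynomial.aeval id : MvPolynomial B O →ₐ[O] B) y = x :=
  ⟨⟨fun i ↦ MvPolynomial.X (x.coeff i)⟩, by ext; simp [mapFun]⟩

protected theorem add_assoc' (x y z : Witt π n B) : x + y + z = x + (y + z) := by
  obtain ⟨x, rfl⟩ := exists_lift x
  obtain ⟨y, rfl⟩ := exists_lift y
  obtain ⟨z, rfl⟩ := exists_lift z
  simp only [← mapFun_mul, ← mapFun_add, ← mapFun_neg]
  congr 1
  exact gh_ext fun i hi ↦ by simp only [gh_add _ _ hi, add_assoc]

protected theorem zero_add' (x : Witt π n B) : 0 + x = x := by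
  obtain ⟨x, rfl⟩ := exists_lift x
  rw [← mapFun_zero (MvPolynomial.aeval id : MvPolynomial B O →ₐ[O] B)]
  simp only [← mapFun_mul, ← mapFun_add, ← mapFun_neg]
  congr 1
  exact gh_ext fun i hi ↦ by simp only [gh_add _ _ hi, gh_zero hi, zero_add]

protected theorem add_comm' (x y : Witt π n B) : x + y = y + x := by
  obtain ⟨x, rfl⟩ := exists_lift x
  obtain ⟨y, rfl⟩ := exists_lift y
  simp only [← mapFun_mul, ← mapFun_add, ← mapFun_neg]
  congr 1
  exact gh_ext fun i hi ↦ by simp only [gh_add _ _ hi, add_comm]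

protected theorem neg_add_cancel' (x : Witt π n B) : -x + x = 0 := by
  obtain ⟨x, rfl⟩ := exists_lift x
  rw [← mapFun_zero (MvPolynomial.aeval id : MvPolynomial B O →ₐ[O] B)]
  simp only [← mapFun_mul, ← mapFun_add, ← mapFun_neg]
  congr 1
  exact gh_ext fun i hi ↦ by simp only [gh_add _ _ hi, gh_neg _ hi, gh_zero hi, neg_add_cancel]

protected theorem mul_assoc' (x y z : Witt π n B) : x * y * z = x * (y * z) := by
  obtain ⟨x, rfl⟩ := exists_lift x
  obtain ⟨y, rfl⟩ := exists_lift y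
  obtain ⟨z, rfl⟩ := exists_lift z
  simp only [← mapFun_mul, ← mapFun_add, ← mapFun_neg]
  congr 1
  exact gh_ext fun i hi ↦ by simp only [gh_mul _ _ hi, mul_assoc]

protected theorem mul_comm' (x y : Witt π n B) : x * y = y * x := by
  obtain ⟨x, rfl⟩ := exists_lift x
  obtain ⟨y, rfl⟩ := exists_lift y
  simp only [← mapFun_mul, ← mapFun_add, ← mapFun_neg]
  congr 1
  exact gh_ext fun i hi ↦ by simp only [gh_mul _ _ hi, mul_comm]

protected theorem one_mul' (x : Witt π n B) : 1 * x = x := by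
  obtain ⟨x, rfl⟩ := exists_lift x
  rw [← mapFun_one (MvPolynomial.aeval id : MvPolynomial B O →ₐ[O] B)]
  simp only [← mapFun_mul, ← mapFun_add, ← mapFun_neg]
  congr 1
  exact gh_ext fun i hi ↦ by simp only [gh_mul _ _ hi, gh_one hi, one_mul]

protected theorem zero_mul' (x : Witt π n B) : 0 * x = 0 := by
  obtain ⟨x, rfl⟩ := exists_lift x
  rw [← mapFun_zero (MvPolynomial.aeval id : MvPolynomial B O →ₐ[O] B)]
  simp only [← mapFun_mul, ← mapFun_add, ← mapFun_neg]
  congr 1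
  exact gh_ext fun i hi ↦ by simp only [gh_mul _ _ hi, gh_zero hi, zero_mul]

protected theorem left_distrib' (x y z : Witt π n B) : x * (y + z) = x * y + x * z := by
  obtain ⟨x, rfl⟩ := exists_lift x
  obtain ⟨y, rfl⟩ := exists_lift y
  obtain ⟨z, rfl⟩ := exists_lift z
  simp only [← mapFun_mul, ← mapFun_add, ← mapFun_neg]
  congr 1
  exact gh_ext fun i hi ↦ by simp only [gh_add _ _ hi, gh_mul _ _ hi, mul_add]

/-- The ring structure on `W_n(B)`: the one, functorial in the `O`-algebra `B`, for which the
ghost components are ring homomorphisms. -/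
instance : CommRing (Witt π n B) where
  add_assoc := Witt.add_assoc'
  zero_add := Witt.zero_add'
  add_zero x := by rw [Witt.add_comm', Witt.zero_add']
  add_comm := Witt.add_comm'
  neg_add_cancel := Witt.neg_add_cancel'
  mul_assoc := Witt.mul_assoc'
  mul_comm := Witt.mul_comm'
  one_mul := Witt.one_mul'
  mul_one x := by rw [Witt.mul_comm', Witt.one_mul']
  zero_mul := Witt.zero_mul'
  mul_zero x := by rw [Witt.mul_comm', Witt.zero_mul']
  left_distrib := Witt.left_distrib'
  right_distrib x y z := by
    rw [Witt.mul_comm', Witt.left_distrib', Witt.mul_comm' z, Witt.mul_comm' z]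
  nsmul := nsmulRec
  zsmul := zsmulRec

theorem const_add (a b : O) : (const (a + b) : Witt π n B) = const a + const b := by
  let f : MvPolynomial B O →ₐ[O] B := MvPolynomial.aeval id
  rw [← mapFun_const f, ← mapFun_const f, ← mapFun_const f, ← mapFun_add]
  congr 1
  exact gh_ext fun i hi ↦ by simp only [gh_const _ hi, gh_add _ _ hi, map_add]

theorem const_mul (a b : O) : (const (a * b) : Witt π n B) = const a * const b := by
  let f : MvPolynomial B O →ₐ[O] B := MvPolynomial.aeval id
  rw [← mapFun_const f, ← mapFun_const f, ← mapFun_const f, ← mapFun_mul]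
  congr 1
  exact gh_ext fun i hi ↦ by simp only [gh_const _ hi, gh_mul _ _ hi, map_mul]

/-- The `O`-algebra structure on `W_n(B)`. -/
instance : Algebra O (Witt π n B) :=
  RingHom.toAlgebra
    { toFun := const
      map_one' := rfl
      map_zero' := by rw [const, map_zero]; rfl
      map_add' := const_add
      map_mul' := const_mul }

theorem algebraMap_def (a : O) : algebraMap O (Witt π n B) a = const a := rfl

/-- The homomorphism `W_n(f)` of `O`-algebras. -/
def map {B' : Type*} [CommRing B'] [Algebra O B'] (f : B →ₐ[O] B') :
    Witt π n B →ₐ[O] Witt π n B' where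
  toFun := mapFun f
  map_one' := mapFun_one f
  map_zero' := mapFun_zero f
  map_add' := mapFun_add f
  map_mul' := mapFun_mul f
  commutes' := mapFun_const f

end

end Witt

/-! ### The exponential map of a prolongation sequence -/

namespace ProlongationSequence

section

variable {O : Type v} [CommRing O] {π : O} (R : ProlongationSequence.{u} π)

/-- For `c` in `C 0` and `j ≤ n`, the image in `C n` under the transition maps of the element
`δ^j c` of `C j` (and `0` for `j > n`). -/
def coord : (n : ℕ) → R.C 0 → ℕ → R.C n
  | 0, c, j => if j = 0 then c else 0
  | n + 1, c, j =>
    if j ≤ n then R.u n (coord n c j) else if j = n + 1 then R.δ n (coord n c n) else 0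

/-- The canonical map `C 0 → W_n(C n)`, `c ↦ (P₀(c), …, P_n(c))`, on sets, where `P_i(c)` is the
value of the polynomial `P_i` at `c, δ c, …, δ^i c`. -/
def expFun (n : ℕ) (c : R.C 0) : Witt π n (R.C n) where
  coeff i := MvPolynomial.aeval (fun s ↦ R.coord n c s.2) (expPoly π i)

theorem coord_u {n : ℕ} (c : R.C 0) {j : ℕ} (hj : j ≤ n) :
    R.coord (n + 1) c j = R.u n (R.coord n c j) := by
  rw [coord, if_pos hj]

theorem coord_δ {n : ℕ} (c : R.C 0) {j : ℕ} (hj : j ≤ n) :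
    R.coord (n + 1) c (j + 1) = R.δ n (R.coord n c j) := by
  induction n with
  | zero =>
    obtain rfl : j = 0 := by omega
    simp [coord]
  | succ n ih =>
    rcases Nat.lt_or_eq_of_le hj with h | rfl
    · rw [R.coord_u c (by omega), ih (by omega), R.u_δ, R.coord_u c (by omega)]
    · rw [coord, if_neg (by omega), if_pos rfl]

end

section

variable {O : Type v} [CommRing O] (π : O)

/-- The `π`-derivation of a polynomial ring given by the lift `phi` of Frobenius. -/
def polyDelta (S : Type w) (a : MvPolynomial (S × ℕ) O) : MvPolynomial (S × ℕ) O :=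
  exactDiv (phi π S a - a ^ resCard π) (MvPolynomial.C π)

/-- The polynomials in the variables `s⁽ʲ⁾` with `j ≤ m`. -/
abbrev level (O : Type v) [CommRing O] (S : Type w) (m : ℕ) :
    Subalgebra O (MvPolynomial (S × ℕ) O) :=
  MvPolynomial.supported O {s : S × ℕ | s.2 ≤ m}

theorem level_mono (S : Type w) {m m' : ℕ} (h : m ≤ m') : level O S m ≤ level O S m' :=
  MvPolynomial.supported_mono fun _ hs ↦ le_trans hs h

theorem X_mem_level {S : Type w} (s : S × ℕ) {m : ℕ} (h : s.2 ≤ m) :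
    (MvPolynomial.X s : MvPolynomial (S × ℕ) O) ∈ level O S m :=
  Algebra.subset_adjoin ⟨s, h, rfl⟩

theorem C_mem_level {S : Type w} (a : O) (m : ℕ) :
    (MvPolynomial.C a : MvPolynomial (S × ℕ) O) ∈ level O S m :=
  (level O S m).algebraMap_mem a

theorem phi_mem {S : Type w} {a : MvPolynomial (S × ℕ) O} {m : ℕ} (ha : a ∈ level O S m) :
    phi π S a ∈ level O S (m + 1) := by
  have : level O S m ≤ (level O S (m + 1)).comap (phi π S) := by
    refine Algebra.adjoin_le ?_
    rintro _ ⟨s, hs, rfl⟩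
    simp only [Subalgebra.coe_comap, Set.mem_preimage, SetLike.mem_coe, phi, MvPolynomial.aeval_X]
    have hs' : s.2 ≤ m := hs
    exact add_mem (pow_mem (X_mem_level _ (by omega)) _)
      (mul_mem (C_mem_level _ _) (X_mem_level _ (by simpa using hs')))
  exact this ha

variable [IsDomain O] [hπ : Fact (Prime π)] [Finite (O ⧸ Ideal.span {π})]

theorem mem_level_of_C_mul {S : Type w} {a : MvPolynomial (S × ℕ) O} {m i : ℕ}
    (h : MvPolynomial.C π ^ i * a ∈ level O S m) : a ∈ level O S m := by
  rw [← map_pow, MvPolynomial.mem_supported,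
    MvPolynomial.vars_C_mul _ (pow_ne_zero i hπ.out.ne_zero)] at h
  exact MvPolynomial.mem_supported.2 h

theorem polyDelta_spec {S : Type w} (a : MvPolynomial (S × ℕ) O) :
    MvPolynomial.C π * polyDelta π S a = phi π S a - a ^ resCard π :=
  mul_exactDiv (dvd_sub_frob π (phi π S) (phi_frob π S) a)

theorem phi_eq {S : Type w} (a : MvPolynomial (S × ℕ) O) :
    phi π S a = a ^ resCard π + MvPolynomial.C π * polyDelta π S a := by
  rw [polyDelta_spec]; ring

theorem polyDelta_eq {S : Type w} {a b : MvPolynomial (S × ℕ) O}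
    (h : phi π S a = a ^ resCard π + MvPolynomial.C π * b) : polyDelta π S a = b := by
  apply mul_left_cancel₀ (C_ne_zero π (S × ℕ))
  rw [polyDelta_spec, h]; ring

theorem polyDelta_X {S : Type w} (s : S × ℕ) :
    polyDelta π S (MvPolynomial.X s) = MvPolynomial.X (s.1, s.2 + 1) :=
  polyDelta_eq π (by simp [phi])

theorem polyDelta_C {S : Type w} (a : O) :
    polyDelta π S (MvPolynomial.C a) = MvPolynomial.C (baseDelta π a) := by
  apply polyDelta_eq
  rw [← map_mul, baseDelta_spec, ← map_pow, ← map_add, phi, MvPolynomial.algHom_C]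
  simp

theorem polyDelta_add {S : Type w} (a b : MvPolynomial (S × ℕ) O) :
    polyDelta π S (a + b) =
      polyDelta π S a + polyDelta π S b + MvPolynomial.aeval ![a, b] (Cpi π) := by
  apply polyDelta_eq
  have := congrArg (MvPolynomial.aeval ![a, b]) (Cpi_spec π)
  simp only [map_mul, map_sub, map_add, map_pow, MvPolynomial.aeval_X, MvPolynomial.aeval_C,
    MvPolynomial.algebraMap_eq, Matrix.cons_val_zero, Matrix.cons_val_one] at this
  rw [mul_add, this, map_add, phi_eq, phi_eq π b]
  ring

theorem polyDelta_mul {S : Type w} (a b : MvPolynomial (S × ℕ) O) :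
    polyDelta π S (a * b) = a ^ resCard π * polyDelta π S b + b ^ resCard π * polyDelta π S a +
      MvPolynomial.C π * polyDelta π S a * polyDelta π S b := by
  apply polyDelta_eq
  rw [map_mul, phi_eq, phi_eq π b]
  ring

theorem polyDelta_mem {S : Type w} {a : MvPolynomial (S × ℕ) O} {m : ℕ} (ha : a ∈ level O S m) :
    polyDelta π S a ∈ level O S (m + 1) := by
  apply mem_level_of_C_mul π (i := 1)
  rw [pow_one, polyDelta_spec]
  exact sub_mem (phi_mem π ha) (pow_mem (level_mono S (Nat.le_succ m) ha) _)

theorem iterate_polyDelta_mem {S : Type w} {a : MvPolynomial (S × ℕ) O}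
    (ha : a ∈ level O S 0) (j : ℕ) : (polyDelta π S)^[j] a ∈ level O S j := by
  induction j with
  | zero => exact ha
  | succ j ih => rw [Function.iterate_succ_apply']; exact polyDelta_mem π ih

theorem expPoly_mem (i : ℕ) : expPoly π i ∈ level O Unit i := by
  induction i using Nat.strong_induction_on with
  | _ i ih =>
    have h := ghost_expPoly π i
    rw [ghost_succ, ← eq_sub_iff_add_eq', MvPolynomial.algebraMap_eq] at h
    apply mem_level_of_C_mul π (i := i)
    rw [h]
    refine sub_mem ?_ (sum_mem fun j _ ↦ mul_mem (pow_mem (C_mem_level _ _) _)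
      (pow_mem (level_mono _ j.2.le (ih j j.2)) _))
    clear ih h
    induction i with
    | zero => exact X_mem_level _ le_rfl
    | succ i ih => rw [Function.iterate_succ_apply']; exact phi_mem π ih

/-- The exponential map of the polynomial ring with its `π`-derivation. -/
def polyExp (n : ℕ) (S : Type w) (a : MvPolynomial (S × ℕ) O) :
    Witt π n (MvPolynomial (S × ℕ) O) where
  coeff i := MvPolynomial.aeval (fun s ↦ (polyDelta π S)^[s.2] a) (expPoly π i)

theorem gh_polyExp {n : ℕ} {S : Type w} (a : MvPolynomial (S × ℕ) O) {i : ℕ} (hi : i ≤ n) :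
    (polyExp π n S a).gh i = (phi π S)^[i] a := by
  let D : MvPolynomial (Unit × ℕ) O →ₐ[O] MvPolynomial (S × ℕ) O :=
    MvPolynomial.aeval (fun s ↦ (polyDelta π S)^[s.2] a)
  have h1 : (polyExp π n S a).gh i = ghost π (fun j ↦ D (expPoly π j)) i :=
    ghost_congr π fun j hj ↦ Witt.get_of_le _ (hj.trans hi)
  rw [h1, ← map_ghost, ghost_expPoly]
  have h2 : ∀ x, D (phi π Unit x) = phi π S (D x) := by
    intro x
    have : D.comp (phi π Unit) = (phi π S).comp D := by
      apply MvPolynomial.algHom_ext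
      intro s
      simp [D, phi_eq, polyDelta_X, Function.iterate_succ_apply']
    exact DFunLike.congr_fun this x
  rw [Function.Semiconj.iterate_right (f := D) h2 i]
  simp [D]

theorem polyExp_add {n : ℕ} {S : Type w} (a b : MvPolynomial (S × ℕ) O) :
    polyExp π n S (a + b) = polyExp π n S a + polyExp π n S b :=
  Witt.gh_ext fun i hi ↦ by
    simp only [Witt.gh_add _ _ hi, gh_polyExp π _ hi, ← AlgHom.coe_pow, map_add]

theorem polyExp_mul {n : ℕ} {S : Type w} (a b : MvPolynomial (S × ℕ) O) :
    polyExp π n S (a * b) = polyExp π n S a * polyExp π n S b :=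
  Witt.gh_ext fun i hi ↦ by
    simp only [Witt.gh_mul _ _ hi, gh_polyExp π _ hi, ← AlgHom.coe_pow, map_mul]

theorem polyExp_C {n : ℕ} {S : Type w} (a : O) :
    polyExp π n S (MvPolynomial.C a) = algebraMap O _ a :=
  Witt.gh_ext fun i hi ↦ by
    rw [Witt.algebraMap_def, Witt.gh_const _ hi, gh_polyExp π _ hi, ← AlgHom.coe_pow,
      MvPolynomial.algHom_C]

end

section

variable {O : Type v} [CommRing O] {π : O} (R : ProlongationSequence.{u} π)

/-- Evaluation at level `n` of the polynomial ring on variables `s⁽ʲ⁾` for `s` in `C 0`. -/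
def ev (n : ℕ) : MvPolynomial (R.C 0 × ℕ) O →ₐ[O] R.C n :=
  MvPolynomial.aeval (fun s ↦ R.coord n s.1 s.2)

theorem ev_u {n : ℕ} {a : MvPolynomial (R.C 0 × ℕ) O} (ha : a ∈ level O (R.C 0) n) :
    R.ev (n + 1) a = R.u n (R.ev n a) := by
  have : level O (R.C 0) n ≤ AlgHom.equalizer (R.ev (n + 1)) ((R.u n).comp (R.ev n)) := by
    refine Algebra.adjoin_le ?_
    rintro _ ⟨s, hs, rfl⟩
    change R.ev (n + 1) _ = R.u n (R.ev n _)
    simp only [ev, MvPolynomial.aeval_X]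
    exact R.coord_u _ hs
  exact this ha

variable [IsDomain O] [hπ : Fact (Prime π)] [Finite (O ⧸ Ideal.span {π})]

theorem ev_δ {n : ℕ} {a : MvPolynomial (R.C 0 × ℕ) O} (ha : a ∈ level O (R.C 0) n) :
    R.ev (n + 1) (polyDelta π _ a) = R.δ n (R.ev n a) := by
  have hl : ∀ x, x ∈ level O (R.C 0) n ↔ x ∈ Algebra.adjoin O
    (MvPolynomial.X '' {s : R.C 0 × ℕ | s.2 ≤ n}) := fun _ ↦ Iff.rfl
  rw [hl] at ha
  induction ha using Algebra.adjoin_induction with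
  | mem x hx =>
    obtain ⟨s, hs, rfl⟩ := hx
    rw [polyDelta_X]
    simp only [ev, MvPolynomial.aeval_X]
    exact R.coord_δ _ hs
  | algebraMap r =>
    rw [MvPolynomial.algebraMap_eq, polyDelta_C]
    simp only [ev, MvPolynomial.aeval_C]
    exact (R.δ_algebraMap n r).symm
  | add x y hx hy h1 h2 =>
    rw [polyDelta_add, map_add, map_add, map_add, h1, h2, (R.isPiDerivation n).add,
      MvPolynomial.comp_aeval_apply, ← R.ev_u hx, ← R.ev_u hy]
    congr 3
    funext i
    fin_cases i <;> rfl
  | mul x y hx hy h1 h2 =>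
    rw [polyDelta_mul, map_mul, (R.isPiDerivation n).mul, ← R.ev_u hx, ← R.ev_u hy, ← h1, ← h2]
    simp only [map_add, map_mul, map_pow]
    congr 3
    simp [ev]

theorem ev_iterate {a : MvPolynomial (R.C 0 × ℕ) O} (ha : a ∈ level O (R.C 0) 0) (n : ℕ) :
    ∀ j ≤ n, R.ev n ((polyDelta π _)^[j] a) = R.coord n (R.ev 0 a) j := by
  induction n with
  | zero =>
    intro j hj
    obtain rfl : j = 0 := by omega
    simp [coord]
  | succ n ih =>
    intro j hj
    rcases Nat.lt_or_eq_of_le hj with h | rfl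
    · have hj' : j ≤ n := by omega
      rw [R.ev_u (level_mono _ hj' (iterate_polyDelta_mem π ha j)), ih j hj', R.coord_u _ hj']
    · rw [Function.iterate_succ_apply', R.ev_δ (iterate_polyDelta_mem π ha n), ih n le_rfl,
        R.coord_δ _ le_rfl]

theorem mapFun_polyExp {a : MvPolynomial (R.C 0 × ℕ) O} (ha : a ∈ level O (R.C 0) 0) (n : ℕ) :
    Witt.mapFun (R.ev n) (polyExp π n _ a) = R.expFun n (R.ev 0 a) := by
  ext i
  simp only [Witt.mapFun, polyExp, expFun, MvPolynomial.comp_aeval_apply]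
  refine MvPolynomial.eval₂Hom_congr' rfl (fun s hs _ ↦ ?_) rfl
  have h1 : s.2 ≤ (i : ℕ) := MvPolynomial.mem_supported.1 (expPoly_mem π i) hs
  exact R.ev_iterate ha n _ (by omega)

theorem exists_ev (c : R.C 0) : ∃ a ∈ level O (R.C 0) 0, R.ev 0 a = c :=
  ⟨MvPolynomial.X (c, 0), X_mem_level _ le_rfl, by simp [ev, coord]⟩

theorem expFun_algebraMap (n : ℕ) (a : O) :
    R.expFun n (algebraMap O _ a) = algebraMap O _ a := by
  have := R.mapFun_polyExp (C_mem_level a 0) n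
  rw [polyExp_C, Witt.algebraMap_def, Witt.mapFun_const] at this
  rw [Witt.algebraMap_def, this]
  simp [ev]

theorem expFun_add (n : ℕ) (x y : R.C 0) :
    R.expFun n (x + y) = R.expFun n x + R.expFun n y := by
  obtain ⟨a, ha, rfl⟩ := R.exists_ev x
  obtain ⟨b, hb, rfl⟩ := R.exists_ev y
  rw [← map_add, ← R.mapFun_polyExp ha, ← R.mapFun_polyExp hb, ← R.mapFun_polyExp (add_mem ha hb),
    polyExp_add, Witt.mapFun_add]

theorem expFun_mul (n : ℕ) (x y : R.C 0) :
    R.expFun n (x * y) = R.expFun n x * R.expFun n y := by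
  obtain ⟨a, ha, rfl⟩ := R.exists_ev x
  obtain ⟨b, hb, rfl⟩ := R.exists_ev y
  rw [← map_mul, ← R.mapFun_polyExp ha, ← R.mapFun_polyExp hb, ← R.mapFun_polyExp (mul_mem ha hb),
    polyExp_mul, Witt.mapFun_mul]

/-- The canonical homomorphism of `O`-algebras `C 0 → W_n(C n)`, `c ↦ (P₀(c), …, P_n(c))`. -/
def exp (n : ℕ) : R.C 0 →ₐ[O] Witt π n (R.C n) where
  toFun := R.expFun n
  map_one' := by simpa using R.expFun_algebraMap n 1
  map_zero' := by simpa using R.expFun_algebraMap n 0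
  map_add' := R.expFun_add n
  map_mul' := R.expFun_mul n
  commutes' := R.expFun_algebraMap n

/-! ### Jet spaces -/

/-- An `R_n`-algebra regarded as an `O`-algebra. -/
abbrev baseAlgebra (n : ℕ) (B : Type w) [CommRing B] [Algebra (R.C n) B] : Algebra O B :=
  Algebra.compHom B (algebraMap O (R.C n))

/-- The structure map `R_n → B` of an `R_n`-algebra, as a homomorphism of `O`-algebras. -/
def structHom (n : ℕ) (B : Type w) [CommRing B] [Algebra (R.C n) B] :
    letI := R.baseAlgebra n B
    R.C n →ₐ[O] B :=
  letI := R.baseAlgebra n B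
  { algebraMap (R.C n) B with commutes' := fun _ ↦ rfl }

/-- A homomorphism of `R_n`-algebras, as a homomorphism of `O`-algebras. -/
def baseHom (n : ℕ) {B B' : Type w} [CommRing B] [Algebra (R.C n) B] [CommRing B']
    [Algebra (R.C n) B'] (f : B →ₐ[R.C n] B') :
    letI := R.baseAlgebra n B
    letI := R.baseAlgebra n B'
    B →ₐ[O] B' :=
  letI := R.baseAlgebra n B
  letI := R.baseAlgebra n B'
  { f.toRingHom with commutes' := fun a ↦ f.commutes (algebraMap O (R.C n) a) }

/-- For an `R_n`-algebra `B`, the `R_0`-algebra structure on the ring `W_n(B)` given by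
`R_0 → W_n(R_n) → W_n(B)`. -/
abbrev wittAlgebra (n : ℕ) (B : Type w) [CommRing B] [Algebra (R.C n) B] :
    letI := R.baseAlgebra n B
    Algebra (R.C 0) (Witt π n B) :=
  letI := R.baseAlgebra n B
  ((Witt.map (R.structHom n B)).comp (R.exp n)).toRingHom.toAlgebra

/-- For a homomorphism `f` of `R_n`-algebras, the homomorphism `W_n(f)` of `R_0`-algebras. -/
def wittHom (n : ℕ) {B B' : Type w} [CommRing B] [Algebra (R.C n) B] [CommRing B']
    [Algebra (R.C n) B'] (f : B →ₐ[R.C n] B') :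
    letI := R.baseAlgebra n B
    letI := R.baseAlgebra n B'
    letI := R.wittAlgebra n B
    letI := R.wittAlgebra n B'
    Witt π n B →ₐ[R.C 0] Witt π n B' :=
  letI := R.baseAlgebra n B
  letI := R.baseAlgebra n B'
  letI := R.wittAlgebra n B
  letI := R.wittAlgebra n B'
  { (Witt.map (R.baseHom n f)).toRingHom with
    commutes' := fun c ↦ Witt.ext (funext fun i ↦ f.commutes ((R.exp n c).coeff i)) }

/-- The functor `W_n` from `R_n`-algebras to `R_0`-algebras. -/
def wittFunctor (n : ℕ) : CommAlgCat.{u} (R.C n) ⥤ CommAlgCat.{u} (R.C 0) where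
  obj B :=
    letI := R.baseAlgebra n B
    letI := R.wittAlgebra n B
    CommAlgCat.of (R.C 0) (Witt π n B)
  map {B B'} f :=
    letI := R.baseAlgebra n B
    letI := R.baseAlgebra n B'
    letI := R.wittAlgebra n B
    letI := R.wittAlgebra n B'
    CommAlgCat.ofHom (R.wittHom n f.hom)
  map_id _ := rfl
  map_comp _ _ := rfl

/-- The functor `J^n` from (pre)sheaves on affine `R_0`-schemes to (pre)sheaves on affine
`R_n`-schemes, `(J^n X)(B) = X(W_n(B))`. -/
def jet (n : ℕ) : (CommAlgCat.{u} (R.C 0) ⥤ Type u) ⥤ (CommAlgCat.{u} (R.C n) ⥤ Type u) :=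
  (Functor.whiskeringLeft _ _ _).obj (R.wittFunctor n)

end

end ProlongationSequence

/-- The functor of points of `A`-schemes: it sends an `A`-scheme `X` to
`B ↦ Hom_A(Spec B, X)` on `A`-algebras `B`. -/
def points (A : Type u) [CommRing A] :
    Over (Spec (CommRingCat.of A)) ⥤ (CommAlgCat.{u} A ⥤ Type u) :=
  yoneda ⋙ (Functor.whiskeringLeft _ _ _).obj (algSpec (CommRingCat.of A)).rightOp

/-- The closed immersions of `A`-schemes. -/
def closedImmersions (A : Type u) [CommRing A] :
    MorphismProperty (Over (Spec (CommRingCat.of A))) :=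
  fun _ _ f ↦ IsClosedImmersion f.left

/-- A map of sheaves on affine `A`-schemes is a closed immersion if for every `A`-scheme `T` and
every map from `T` to its target, the base change of the map to `T` is (representable by) a closed
immersion of schemes. Sheaves form a full subcategory of the functors `CommAlgCat A ⥤ Type`,
closed under fibre products, so maps and base changes of sheaves are those of functors. -/
def IsSheafClosedImmersion {A : Type u} [CommRing A] {F G : CommAlgCat.{u} A ⥤ Type u}
    (f : F ⟶ G) : Prop :=
  (closedImmersions A).relative (points A) f

end PiJet

end

noncomputable section

namespace PiJet

/-! ### Closed subschemes cut out by conditions on affine points -/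

/-! Two facts about `J^n f` suffice: it is injective on points, and the points of its target that
lift form a closed condition, meaning that for every point `y` over an algebra `B` some ideal `J` of
`B` has the property that `y` lifts after `B → B'` exactly when `J` dies in `B'`.

Injectivity is immediate: on `B`, the map `J^n f` is `f` on `W_n(B)`-points, and a closed immersion
is a monomorphism. For closedness, let `y` be a `W_n(B)`-point of `Y`. As `f` is a closed immersion,
`y` lifts over a `W_n(B)`-algebra if and only if a certain ideal `I` of `W_n(B)` is killed. Now
`W_n(B) → W_n(B')` kills a Witt vector exactly when `B → B'` kills all its components, so the ideal
of `B` generated by the components of the elements of `I` does the job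
(`Witt.coeffIdeal_le_ker_iff`, `ProlongationSequence.liftsAreClosed_jet`).

The rest is a general criterion, `LiftsAreClosed.isSheafClosedImmersion`. Pulled back to a scheme
`T`, a closed condition assigns an ideal to each affine point, and these ideals are compatible with
base change because an ideal is determined by the ring maps that kill it. They therefore form an
ideal sheaf on `T`. Its closed subscheme has exactly the right affine points
(`IsClosedCondition.factor_iff`), so it represents the base change; any other representing scheme
has the same affine points over `T` and is isomorphic to it (`IsClosedCondition.isClosedImmersion`).
-/

/-- A morphism factors through a monomorphism if it does so locally on its source. -/
theorem exists_factor_of_locally {Z T W : Scheme.{u}} (i : Z ⟶ T) [Mono i] (t : W ⟶ T)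
    (H : ∀ p : W, ∃ (V : Scheme.{u}) (j : V ⟶ W), IsOpenImmersion j ∧ p ∈ Set.range j ∧
      ∃ z : V ⟶ Z, z ≫ i = j ≫ t) : ∃ z : W ⟶ Z, z ≫ i = t := by
  choose V j hj hp z hz using H
  let c : W.OpenCover :=
    { I₀ := W
      X := V
      f := j
      mem₀ := by
        rw [Scheme.presieve₀_mem_precoverage_iff]
        exact ⟨fun p ↦ ⟨p, hp p⟩, hj⟩ }
  refine ⟨c.glueMorphisms z fun p q ↦ ?_, c.hom_ext _ _ fun p ↦ ?_⟩
  -- Factorizations through a monomorphism are unique, so the local ones agree on overlaps.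
  · rw [← cancel_mono i, Category.assoc, Category.assoc, hz, hz]
    exact Limits.pullback.condition_assoc _
  · rw [Scheme.Cover.ι_glueMorphisms_assoc]
    exact hz p

/-- A morphism to `T` can be covered by morphisms between affine opens. -/
theorem exists_local_chart {T W : Scheme.{u}} (t : W ⟶ T) (p : W) :
    ∃ (U : T.Opens) (hU : IsAffineOpen U) (V : W.Opens) (hV : IsAffineOpen V)
      (φ : Γ(T, U) ⟶ Γ(W, V)), p ∈ V ∧ hV.fromSpec ≫ t = Spec.map φ ≫ hU.fromSpec := by
  obtain ⟨U, hU, hpU, -⟩ := exists_isAffineOpen_mem_and_subset (X := T) (U := ⊤) (x := t p) trivial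
  obtain ⟨V, hV, hpV, hVU⟩ := exists_isAffineOpen_mem_and_subset (X := W) (U := t ⁻¹ᵁ U) (x := p) hpU
  exact ⟨U, hU, V, hV, t.appLE U V hVU, hpV, (hU.SpecMap_appLE_fromSpec t hV hVU).symm⟩

/-- Maps to an affine scheme factor through a closed subscheme if and only if they kill its
ideal. -/
theorem exists_factor_quotient_iff {A B : CommRingCat.{u}} (I : Ideal A) (φ : A ⟶ B) :
    (∃ z : Spec B ⟶ Spec (CommRingCat.of (A ⧸ I)),
      z ≫ Spec.map (CommRingCat.ofHom (Ideal.Quotient.mk I)) = Spec.map φ) ↔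
      I ≤ RingHom.ker φ.hom := by
  constructor
  · rintro ⟨z, hz⟩ a ha
    rw [← Spec.map_preimage z, ← Spec.map_comp] at hz
    rw [← Spec.map_injective hz, RingHom.mem_ker]
    simp [Ideal.Quotient.eq_zero_iff_mem.2 ha]
  · intro h
    refine ⟨Spec.map (CommRingCat.ofHom (Ideal.Quotient.lift I φ.hom h)), ?_⟩
    rw [← Spec.map_comp]
    rfl

/-- A condition on the affine points of `T` that is closed: on every affine point, it is given by
the vanishing of an ideal, compatibly with base change. -/
def IsClosedCondition {T : Scheme.{u}} (P : ∀ A : CommRingCat.{u}, (Spec A ⟶ T) → Prop) : Prop :=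
  ∀ (A : CommRingCat.{u}) (x : Spec A ⟶ T), ∃ J : Ideal A,
    ∀ (B : CommRingCat.{u}) (φ : A ⟶ B), P B (Spec.map φ ≫ x) ↔ J ≤ RingHom.ker φ.hom

/-- The base change of `f` to `Spec A` is a closed immersion into an affine scheme, hence `Spec (A ⧸
I)` for some `I`; this `I` is the required ideal. -/
theorem isClosedCondition_factor {Z T : Scheme.{u}} (f : Z ⟶ T) [IsClosedImmersion f] :
    IsClosedCondition fun A (x : Spec A ⟶ T) ↦ ∃ z : Spec A ⟶ Z, z ≫ f = x := by
  intro A x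
  obtain ⟨I, e, he⟩ := IsClosedImmersion.Spec_iff.1
    (show IsClosedImmersion (Limits.pullback.snd f x) from inferInstance)
  refine ⟨I, fun B φ ↦ Iff.trans ?_ (exists_factor_quotient_iff I φ)⟩
  constructor
  · rintro ⟨z, hz⟩
    refine ⟨Limits.pullback.lift z (Spec.map φ) hz ≫ e.hom, ?_⟩
    rw [Category.assoc, ← he, Limits.pullback.lift_snd]
  · rintro ⟨z, hz⟩
    refine ⟨z ≫ e.inv ≫ Limits.pullback.fst f x, ?_⟩
    rw [Category.assoc, Category.assoc, Limits.pullback.condition, he, Category.assoc,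
      e.inv_hom_id_assoc, reassoc_of% hz]

/-! ### The closed subscheme defined by a closed condition -/

namespace IsClosedCondition

variable {T : Scheme.{u}} {P : ∀ A : CommRingCat.{u}, (Spec A ⟶ T) → Prop}
  (hP : IsClosedCondition P)

/-- The ideal defining a closed condition on an affine point. -/
def idealAt {A : CommRingCat.{u}} (x : Spec A ⟶ T) : Ideal A := (hP A x).choose

theorem iff_idealAt_le {A B : CommRingCat.{u}} (x : Spec A ⟶ T) (φ : A ⟶ B) :
    P B (Spec.map φ ≫ x) ↔ hP.idealAt x ≤ RingHom.ker φ.hom :=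
  (hP A x).choose_spec B φ

include hP in
theorem comp {A B : CommRingCat.{u}} {x : Spec A ⟶ T} (hx : P A x) (φ : A ⟶ B) :
    P B (Spec.map φ ≫ x) := by
  -- Testing on the identity shows that the ideal at `x` is zero.
  have h := (hP.iff_idealAt_le x (𝟙 A)).1 (by simpa using hx)
  rw [hP.iff_idealAt_le]
  intro a ha
  have : a = 0 := h ha
  simp [this]

/-- Both ideals are contained in the kernels of the same maps out of `B`. Testing on the quotient by
either one gives the two inclusions. This is the compatibility that makes `idealSheaf` an ideal
sheaf. -/
theorem idealAt_comp {A B : CommRingCat.{u}} (x : Spec A ⟶ T) (φ : A ⟶ B) :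
    hP.idealAt (Spec.map φ ≫ x) = (hP.idealAt x).map φ.hom := by
  have key : ∀ (C : CommRingCat.{u}) (ψ : B ⟶ C),
      hP.idealAt (Spec.map φ ≫ x) ≤ RingHom.ker ψ.hom ↔
        (hP.idealAt x).map φ.hom ≤ RingHom.ker ψ.hom := by
    intro C ψ
    rw [← hP.iff_idealAt_le, ← Spec.map_comp_assoc, hP.iff_idealAt_le, Ideal.map_le_iff_le_comap,
      RingHom.comap_ker]
    rfl
  have hk (I : Ideal B) :
      RingHom.ker (CommRingCat.ofHom (Ideal.Quotient.mk I)).hom = I := Ideal.mk_ker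
  apply le_antisymm
  · simpa only [hk] using (key _ (CommRingCat.ofHom (Ideal.Quotient.mk
      ((hP.idealAt x).map φ.hom)))).2 (hk _).ge
  · simpa only [hk] using (key _ (CommRingCat.ofHom (Ideal.Quotient.mk
      (hP.idealAt (Spec.map φ ≫ x))))).1 (hk _).ge

include hP in
/-- Closed conditions can be checked locally. -/
theorem of_locally {A : CommRingCat.{u}} (x : Spec A ⟶ T)
    (H : ∀ p : Spec A, ∃ (B : CommRingCat.{u}) (j : Spec B ⟶ Spec A), IsOpenImmersion j ∧
      p ∈ Set.range j ∧ P B (j ≫ x)) : P A x := by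
  -- `P A x` says that the ideal at `x` is zero, that is, that the identity of `Spec A` factors
  -- through the closed subscheme of that ideal. Factoring through a monomorphism is local on the
  -- source.
  suffices ∃ z, z ≫ Spec.map (CommRingCat.ofHom (Ideal.Quotient.mk (hP.idealAt x))) =
      Spec.map (𝟙 A) by
    simpa using (hP.iff_idealAt_le x (𝟙 A)).2 ((exists_factor_quotient_iff _ _).1 this)
  refine exists_factor_of_locally _ _ fun p ↦ ?_
  obtain ⟨B, j, hj, hp, hPj⟩ := H p
  refine ⟨Spec B, j, hj, hp, ?_⟩
  rw [← Spec.map_preimage j, hP.iff_idealAt_le] at hPj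
  obtain ⟨z, hz⟩ := (exists_factor_quotient_iff _ _).2 hPj
  exact ⟨z, by simpa using hz⟩

/-- The ideal sheaf of the closed subscheme defined by a closed condition. -/
def idealSheaf : T.IdealSheafData where
  ideal U := hP.idealAt U.2.fromSpec
  map_ideal_basicOpen U f := by
    rw [← hP.idealAt_comp]
    congr 1
    exact U.2.map_fromSpec (U.2.basicOpen f) (homOfLE (T.basicOpen_le f)).op

theorem exists_subscheme_chart {U : T.Opens} (hU : IsAffineOpen U) :
    ∃ k : Spec (CommRingCat.of (Γ(T, U) ⧸ hP.idealAt hU.fromSpec)) ⟶ hP.idealSheaf.subscheme,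
      IsOpenImmersion k ∧
      Set.range k = hP.idealSheaf.subschemeι ⁻¹' U ∧
      k ≫ hP.idealSheaf.subschemeι =
        Spec.map (CommRingCat.ofHom (Ideal.Quotient.mk (hP.idealAt hU.fromSpec))) ≫
          hU.fromSpec := by
  let U' : T.affineOpens := ⟨U, hU⟩
  have h : IsOpenImmersion (hP.idealSheaf.subschemeCover.f U') :=
    hP.idealSheaf.subschemeCover.map_prop U'
  exact ⟨hP.idealSheaf.subschemeCover.f U', h,
    congrArg (fun V : hP.idealSheaf.subscheme.Opens ↦ (V : Set hP.idealSheaf.subscheme))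
      (hP.idealSheaf.opensRange_subschemeCover_map U'),
    (hP.idealSheaf.subschemeCover_map_subschemeι U').trans
      (hP.idealSheaf.glueDataObjι_ι U')⟩

/-- The chart of the subscheme over `U` is the full preimage of `U`, so a point of the subscheme
lying over `U` lands in the chart, where factoring means killing the ideal. -/
theorem chart_factor_iff {U : T.Opens} (hU : IsAffineOpen U) {B : CommRingCat.{u}}
    (φ : Γ(T, U) ⟶ B) :
    (∃ z : Spec B ⟶ hP.idealSheaf.subscheme,
      z ≫ hP.idealSheaf.subschemeι = Spec.map φ ≫ hU.fromSpec) ↔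
      P B (Spec.map φ ≫ hU.fromSpec) := by
  rw [hP.iff_idealAt_le, ← exists_factor_quotient_iff]
  obtain ⟨k, hk, hr, e⟩ := hP.exists_subscheme_chart hU
  constructor
  · rintro ⟨z, hz⟩
    have hzr : Set.range z ⊆ Set.range k := by
      rw [hr]
      rintro _ ⟨p, rfl⟩
      rw [Set.mem_preimage, ← Scheme.Hom.comp_apply, hz, Scheme.Hom.comp_apply,
        ← hU.range_fromSpec]
      exact ⟨_, rfl⟩
    refine ⟨IsOpenImmersion.lift k z hzr, ?_⟩
    rw [← cancel_mono hU.fromSpec, Category.assoc, ← e, IsOpenImmersion.lift_fac_assoc, hz]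
  · rintro ⟨z, hz⟩
    exact ⟨z ≫ k, by rw [Category.assoc, e, reassoc_of% hz]⟩

/-- Both sides are local on `Spec A`, and locally `x` maps an affine open into an affine open of
`T`, where `chart_factor_iff` applies. -/
theorem factor_iff {A : CommRingCat.{u}} (x : Spec A ⟶ T) :
    (∃ z : Spec A ⟶ hP.idealSheaf.subscheme, z ≫ hP.idealSheaf.subschemeι = x) ↔ P A x := by
  constructor
  · rintro ⟨z, hz⟩
    refine hP.of_locally x fun p ↦ ?_
    obtain ⟨U, hU, V, hV, φ, hp, h⟩ := exists_local_chart x p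
    refine ⟨_, hV.fromSpec, inferInstance, by rwa [hV.range_fromSpec], ?_⟩
    rw [h, ← hP.chart_factor_iff hU, ← h, ← hz]
    exact ⟨hV.fromSpec ≫ z, by simp⟩
  · intro hx
    refine exists_factor_of_locally _ _ fun p ↦ ?_
    obtain ⟨U, hU, V, hV, φ, hp, h⟩ := exists_local_chart x p
    refine ⟨_, hV.fromSpec, inferInstance, by rwa [hV.range_fromSpec], ?_⟩
    rw [h, hP.chart_factor_iff hU, ← h, ← Spec.map_preimage hV.fromSpec]
    exact hP.comp hx _

-- The map `i` and the inclusion of the subscheme of `P` are monomorphisms with the same affine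
-- points. Each factors through the other, locally and therefore globally, so they differ by an
-- isomorphism.
include hP in
theorem isClosedImmersion {Z : Scheme.{u}} (i : Z ⟶ T)
    (hi : ∀ (A : CommRingCat.{u}) (z z' : Spec A ⟶ Z), z ≫ i = z' ≫ i → z = z')
    (h : ∀ (A : CommRingCat.{u}) (x : Spec A ⟶ T), P A x ↔ ∃ z : Spec A ⟶ Z, z ≫ i = x) :
    IsClosedImmersion i := by
  have : Mono i := ⟨fun {W} a b hab ↦ by
    refine W.affineCover.hom_ext _ _ fun k ↦ hi _ _ _ ?_
    exact (Category.assoc _ _ _).trans ((congrArg _ hab).trans (Category.assoc _ _ _).symm)⟩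
  let ι := hP.idealSheaf.subschemeι
  obtain ⟨a, ha⟩ : ∃ a, a ≫ ι = i := exists_factor_of_locally ι i fun p ↦ by
    obtain ⟨A, j, hj, hp, -⟩ := Scheme.exists_affine_mem_range_and_range_subset (x := p)
      (U := ⊤) trivial
    exact ⟨_, j, hj, hp, (hP.factor_iff _).2 ((h _ _).2 ⟨_, rfl⟩)⟩
  obtain ⟨b, hb⟩ : ∃ b, b ≫ i = ι := exists_factor_of_locally i ι fun p ↦ by
    obtain ⟨A, j, hj, hp, -⟩ := Scheme.exists_affine_mem_range_and_range_subset (x := p)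
      (U := ⊤) trivial
    exact ⟨_, j, hj, hp, (h _ _).1 ((hP.factor_iff _).1 ⟨_, rfl⟩)⟩
  have : IsIso a := ⟨b, by rw [← cancel_mono i, Category.assoc, hb, ha, Category.id_comp],
    by rw [← cancel_mono ι, Category.assoc, ha, hb, Category.id_comp]⟩
  rw [← ha]
  infer_instance

end IsClosedCondition

/-! ### Functors on algebras -/

section Functors

variable {A : Type u} [CommRing A]

variable {T T' : Over (Spec (CommRingCat.of A))}

/-- The morphism of schemes underlying a `B`-valued point. -/
def pointHom {B : CommAlgCat.{u} A} (t : ((points A).obj T).obj B) :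
    Spec (CommRingCat.of B) ⟶ T.left :=
  Over.Hom.left (show (algSpec (CommRingCat.of A)).obj (Opposite.op B) ⟶ T from t)

/-- The `B`-valued point with a given underlying morphism of schemes. -/
def pointMk {B : CommAlgCat.{u} A} (x : Spec (CommRingCat.of B) ⟶ T.left)
    (h : x ≫ T.hom = Spec.map (CommRingCat.ofHom (algebraMap A B))) :
    ((points A).obj T).obj B :=
  Over.homMk (U := (algSpec (CommRingCat.of A)).obj (Opposite.op B)) x h

theorem pointHom_w {B : CommAlgCat.{u} A} (t : ((points A).obj T).obj B) :
    pointHom t ≫ T.hom = Spec.map (CommRingCat.ofHom (algebraMap A B)) :=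
  Over.w (show (algSpec (CommRingCat.of A)).obj (Opposite.op B) ⟶ T from t)

theorem pointHom_map_app (f : T ⟶ T') {B : CommAlgCat.{u} A} (t : ((points A).obj T).obj B) :
    pointHom (((points A).map f).app B t) = pointHom t ≫ f.left := rfl

theorem pointHom_injective {B : CommAlgCat.{u} A} :
    Function.Injective (pointHom (T := T) (B := B)) :=
  fun _ _ h ↦ Over.OverMorphism.ext h

/-- An affine point of an `A`-scheme is defined over an `A`-algebra. -/
def pointAlg {B : CommRingCat.{u}} (x : Spec B ⟶ T.left) : CommAlgCat.{u} A :=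
  letI : Algebra A B := (Spec.preimage (x ≫ T.hom)).hom.toAlgebra
  CommAlgCat.of A B

theorem pointAlg_w {B : CommRingCat.{u}} (x : Spec B ⟶ T.left) :
    x ≫ T.hom = Spec.map (CommRingCat.ofHom (algebraMap A (pointAlg x))) :=
  (Spec.map_preimage (x ≫ T.hom)).symm

/-- An affine point of an `A`-scheme, as an element of its functor of points. -/
def point {B : CommRingCat.{u}} (x : Spec B ⟶ T.left) : ((points A).obj T).obj (pointAlg x) :=
  pointMk x (pointAlg_w x)

/-- A morphism of points of `T` over a homomorphism of rings is given by a homomorphism of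
`A`-algebras. -/
theorem exists_points_map {B B' : CommAlgCat.{u} A}
    (s : ((points A).obj T).obj B) (t : ((points A).obj T).obj B')
    (φ : CommRingCat.of B ⟶ CommRingCat.of B') (h : pointHom t = Spec.map φ ≫ pointHom s) :
    ∃ ψ : B ⟶ B', ψ.hom.toRingHom = φ.hom ∧ ((points A).obj T).map ψ s = t := by
  have hφ : CommRingCat.ofHom (algebraMap A B) ≫ φ = CommRingCat.ofHom (algebraMap A B') := by
    apply Spec.map_injective
    rw [Spec.map_comp, ← pointHom_w s, ← pointHom_w t, h, Category.assoc]
  let ψ : B →ₐ[A] B' :=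
    { φ.hom with commutes' := fun a ↦ congrArg (fun χ ↦ χ.hom a) hφ }
  exact ⟨CommAlgCat.ofHom ψ, rfl, pointHom_injective h.symm⟩

/-- The points of `G` that lift along `f : F ⟶ G` form a closed condition. -/
def LiftsAreClosed {F G : CommAlgCat.{u} A ⥤ Type u} (f : F ⟶ G) : Prop :=
  ∀ (B : CommAlgCat.{u} A) (y : G.obj B), ∃ J : Ideal B, ∀ (B' : CommAlgCat.{u} A) (φ : B ⟶ B'),
    G.map φ y ∈ Set.range (f.app B') ↔ J ≤ RingHom.ker φ.hom.toRingHom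

/-! ### Base changes of a map of functors whose image is a closed condition -/

section

variable {F G : CommAlgCat.{u} A ⥤ Type u} (f : F ⟶ G)

theorem map_mem_range_app {B B' : CommAlgCat.{u} A} (φ : B ⟶ B') {y : G.obj B}
    (h : y ∈ Set.range (f.app B)) : G.map φ y ∈ Set.range (f.app B') := by
  obtain ⟨x, rfl⟩ := h
  exact ⟨F.map φ x, NatTrans.naturality_apply f φ x⟩

/-- The affine points of `T` whose image under `g` lifts along `f`. -/
def Lifts (g : (points A).obj T ⟶ G) (B : CommRingCat.{u}) (x : Spec B ⟶ T.left) : Prop :=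
  ∃ (C : CommAlgCat.{u} A) (t : ((points A).obj T).obj C) (φ : CommRingCat.of C ⟶ B),
    x = Spec.map φ ≫ pointHom t ∧ g.app _ t ∈ Set.range (f.app C)

/-- `Lifts` concerns bare rings and allows the point to come from another algebra `C`. Nothing is
gained by this: the map from `C` is a homomorphism of `A`-algebras, along which a lift over `C` can
be pushed forward. -/
theorem lifts_pointHom_iff (g : (points A).obj T ⟶ G) {B : CommAlgCat.{u} A}
    (t : ((points A).obj T).obj B) :
    Lifts f g (CommRingCat.of B) (pointHom t) ↔ g.app _ t ∈ Set.range (f.app B) := by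
  constructor
  · rintro ⟨C, s, φ, h, hs⟩
    obtain ⟨ψ, -, rfl⟩ := exists_points_map s t φ h
    rw [NatTrans.naturality_apply]
    exact map_mem_range_app f ψ hs
  · intro ht
    exact ⟨B, t, 𝟙 _, by rw [Spec.map_id, Category.id_comp], ht⟩

theorem lifts_iff (g : (points A).obj T ⟶ G) {B : CommRingCat.{u}} (x : Spec B ⟶ T.left) :
    Lifts f g B x ↔ g.app _ (point x) ∈ Set.range (f.app (pointAlg x)) :=
  lifts_pointHom_iff f g (point x)

variable {f}

/-- An affine point of `T` makes its ring an `A`-algebra, and ring maps between such points respect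
these structures. Thus the ideal given by `hf` for `A`-algebras also serves for all rings. -/
theorem LiftsAreClosed.isClosedCondition (hf : LiftsAreClosed f) (g : (points A).obj T ⟶ G) :
    IsClosedCondition (Lifts f g) := by
  intro B x
  obtain ⟨J, hJ⟩ := hf (pointAlg x) (g.app _ (point x))
  refine ⟨J, fun B' φ ↦ ?_⟩
  obtain ⟨ψ, hψ, e⟩ := exists_points_map (point x) (point (Spec.map φ ≫ x)) φ rfl
  have h := hJ _ ψ
  rw [← NatTrans.naturality_apply, e, hψ] at h
  exact (lifts_iff f g _).trans h

theorem injective_points_map (f : T ⟶ T') [Mono f.left] (B : CommAlgCat.{u} A) :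
    Function.Injective (((points A).map f).app B) := by
  intro x x' h
  apply pointHom_injective
  rw [← cancel_mono f.left, ← pointHom_map_app, ← pointHom_map_app, h]

/-- A monomorphism of schemes represents the base change of an injective map `f` along `g` if its
points are those that `g` sends into the image of `f`. -/
theorem exists_isPullback_of_mem_range_iff (hf : ∀ B, Function.Injective (f.app B))
    {Z : Over (Spec (CommRingCat.of A))} (i : Z ⟶ T) [Mono i.left] (g : (points A).obj T ⟶ G)
    (h : ∀ (B : CommAlgCat.{u} A) (t : ((points A).obj T).obj B),
      t ∈ Set.range (((points A).map i).app B) ↔ g.app B t ∈ Set.range (f.app B)) :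
    ∃ fst : (points A).obj Z ⟶ F, IsPullback fst ((points A).map i) f g := by
  -- Lifts along `f` are unique by `hf`, so these choices are natural.
  choose a ha using fun (B : CommAlgCat.{u} A) (z : ((points A).obj Z).obj B) ↦
    (h B (((points A).map i).app B z)).1 ⟨z, rfl⟩
  let fst : (points A).obj Z ⟶ F :=
    { app B := ↾(a B)
      naturality B B' φ := by
        ext z
        apply hf
        change f.app B' (a B' (((points A).obj Z).map φ z)) = f.app B' (F.map φ (a B z))
        rw [ha, NatTrans.naturality_apply, NatTrans.naturality_apply, NatTrans.naturality_apply,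
          ha] }
  refine ⟨fst, .of_forall_isPullback_app fun B ↦ (Limits.Types.isPullback_iff _ _ _ _).2
    ⟨?_, ?_, ?_⟩⟩
  · ext z
    exact ha B z
  · exact fun z z' e ↦ injective_points_map i B e.2
  · intro x t e
    obtain ⟨z, rfl⟩ := (h B t).2 ⟨x, e⟩
    exact ⟨z, hf B ((ha B z).trans e.symm), rfl⟩

/-- A map of functors that is injective on points and whose image is a closed condition is a
closed immersion. -/
theorem LiftsAreClosed.isSheafClosedImmersion (hf : LiftsAreClosed f)
    (hinj : ∀ B, Function.Injective (f.app B)) : IsSheafClosedImmersion f := by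
  -- The two halves of `relative`: every base change is representable, and whichever morphism `snd`
  -- represents it is a closed immersion. In the second half `Z` is arbitrary, so it is compared
  -- with the subscheme of the condition through its affine points.
  refine ⟨fun T g ↦ ?_, fun T Z g fst snd h ↦ ?_⟩
  · let P := hf.isClosedCondition g
    let Z : Over (Spec (CommRingCat.of A)) := Over.mk (P.idealSheaf.subschemeι ≫ T.hom)
    let i : Z ⟶ T := Over.homMk P.idealSheaf.subschemeι
    have : Mono i.left := inferInstanceAs (Mono P.idealSheaf.subschemeι)
    refine ⟨Z, i, exists_isPullback_of_mem_range_iff hinj i g fun B t ↦ ?_⟩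
    rw [← lifts_pointHom_iff f g t, ← P.factor_iff]
    constructor
    · rintro ⟨z, rfl⟩
      exact ⟨pointHom z, rfl⟩
    · rintro ⟨z, hz⟩
      refine ⟨pointMk z ?_, pointHom_injective hz⟩
      rw [← pointHom_w t, ← hz]
      exact (Category.assoc _ _ _).symm
  · have hw {B : CommAlgCat.{u} A} (z : ((points A).obj Z).obj B) :
        f.app B (fst.app B z) = g.app B (((points A).map snd).app B z) :=
      congr(($h.w).app B z)
    have hB (B : CommAlgCat.{u} A) :=
      (Limits.Types.isPullback_iff _ _ _ _).1 (h.map ((evaluation _ _).obj B))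
    have inj {B : CommAlgCat.{u} A} {z z' : ((points A).obj Z).obj B}
        (e : ((points A).map snd).app B z = ((points A).map snd).app B z') : z = z' :=
      (hB B).2.1 z z' ⟨hinj B ((hw z).trans ((congrArg _ e).trans (hw z').symm)), e⟩
    have surj {B : CommAlgCat.{u} A} {t : ((points A).obj T).obj B}
        (ht : g.app _ t ∈ Set.range (f.app B)) : ∃ z, ((points A).map snd).app B z = t := by
      obtain ⟨y, hy⟩ := ht
      obtain ⟨z, -, hz⟩ := (hB B).2.2 y t hy
      exact ⟨z, hz⟩
    refine (hf.isClosedCondition g).isClosedImmersion snd.left (fun B z z' e ↦ ?_) fun B x ↦ ?_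
    -- Since `z` and `z'` agree in `T`, they induce the same `A`-algebra structure on `B`, and
    -- injectivity on points over that algebra applies.
    · have hz' : z' ≫ Z.hom = Spec.map (CommRingCat.ofHom (algebraMap A (pointAlg z))) := by
        rw [← pointAlg_w z, ← Over.w snd, reassoc_of% e]
      have e' : point z = pointMk (B := pointAlg z) z' hz' := inj (pointHom_injective e)
      exact congrArg pointHom e'
    · rw [lifts_iff]
      constructor
      · intro hx
        obtain ⟨z, hz⟩ := surj hx
        exact ⟨pointHom z, congrArg pointHom hz⟩
      · rintro ⟨z, hz⟩
        have hz' : z ≫ Z.hom = Spec.map (CommRingCat.ofHom (algebraMap A (pointAlg x))) := by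
          rw [← pointAlg_w x, ← Over.w snd, reassoc_of% hz]
        have e : ((points A).map snd).app _ (pointMk (B := pointAlg x) z hz') = point x :=
          pointHom_injective hz
        rw [← e, ← hw]
        exact ⟨_, rfl⟩

end

theorem liftsAreClosed_points (f : T ⟶ T') [IsClosedImmersion f.left] :
    LiftsAreClosed ((points A).map f) := by
  intro B y
  obtain ⟨J, hJ⟩ := isClosedCondition_factor f.left (CommRingCat.of B) (pointHom y)
  refine ⟨J, fun B' φ ↦ Iff.trans ?_ (hJ (CommRingCat.of B') (CommRingCat.ofHom φ.hom.toRingHom))⟩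
  constructor
  · rintro ⟨x, hx⟩
    exact ⟨pointHom x, congrArg pointHom hx⟩
  · rintro ⟨z, hz⟩
    -- The factorization `z` is automatically a morphism over `A`, because `f` is.
    refine ⟨pointMk z ?_, pointHom_injective hz⟩
    rw [← Over.w f, reassoc_of% hz]
    exact pointHom_w (((points A).obj T').map φ y)

end Functors

/-! ### Truncated Witt vectors -/

namespace Witt

variable {O : Type v} [CommRing O] {π : O} [IsDomain O] [hπ : Fact (Prime π)]
  [Finite (O ⧸ Ideal.span {π})] {n : ℕ} {B B' : Type*} [CommRing B] [Algebra O B]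
  [CommRing B'] [Algebra O B']

/-- The zero of `W_n(B)` is defined by structure polynomials. Over a polynomial ring the ghost
components determine a Witt vector, and those of the vector with zero components vanish;
functoriality carries the result to `B`. -/
theorem coeff_zero (i : Fin (n + 1)) : (0 : Witt π n B).coeff i = 0 := by
  have h : (0 : Witt π n (MvPolynomial Empty O)) = ⟨fun _ ↦ 0⟩ := by
    refine gh_ext fun j hj ↦ ?_
    rw [gh_zero hj, gh, ghost]
    refine (Finset.sum_eq_zero fun k _ ↦ ?_).symm
    have : get (⟨fun _ ↦ 0⟩ : Witt π n (MvPolynomial Empty O)) k = 0 := by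
      unfold get
      split <;> rfl
    rw [this, zero_pow (pow_ne_zero _ (resCard_pos π).ne'), mul_zero]
  let f : MvPolynomial Empty O →ₐ[O] B := MvPolynomial.aeval Empty.elim
  rw [← mapFun_zero f, h]
  exact map_zero f

/-- The ideal generated by the components of the elements of an ideal of `W_n(B)`. -/
def coeffIdeal (I : Ideal (Witt π n B)) : Ideal B :=
  Ideal.span {b | ∃ x ∈ I, ∃ i, x.coeff i = b}

/-- `W_n(f)` acts componentwise and the zero Witt vector has zero components, so `W_n(f)` kills `x`
exactly when `f` kills every component of `x`. -/
theorem coeffIdeal_le_ker_iff (I : Ideal (Witt π n B)) (f : B →ₐ[O] B') :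
    coeffIdeal I ≤ RingHom.ker f.toRingHom ↔ I ≤ RingHom.ker (map (n := n) f).toRingHom := by
  rw [coeffIdeal, Ideal.span_le]
  constructor
  · intro h x hx
    ext i
    rw [coeff_zero]
    exact h ⟨x, hx, i, rfl⟩
  · rintro h _ ⟨x, hx, i, rfl⟩
    have : mapFun f x = 0 := h hx
    exact (congrArg (fun y ↦ coeff y i) this).trans (coeff_zero i)

end Witt

/-! ### Closedness of the image for jets -/

theorem ProlongationSequence.liftsAreClosed_jet {O : Type v} [CommRing O] [IsDomain O] {π : O}
    [Fact (Prime π)] [Finite (O ⧸ Ideal.span {π})] (R : ProlongationSequence.{u} π) (n : ℕ)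
    {F G : CommAlgCat.{u} (R.C 0) ⥤ Type u} {f : F ⟶ G} (hf : LiftsAreClosed f) :
    LiftsAreClosed ((R.jet n).map f) := by
  intro B y
  -- A point of the jet functor over `B` is a point of `G` over `W_n(B)`, so `hf` gives an ideal of
  -- `W_n(B)`; `coeffIdeal` brings it down to `B`.
  obtain ⟨I, hI⟩ := hf ((R.wittFunctor n).obj B) y
  let _ := R.baseAlgebra n B
  let I' : Ideal (Witt π n B) := I
  refine ⟨Witt.coeffIdeal I', fun B' φ ↦ ?_⟩
  let _ := R.baseAlgebra n B'
  have h1 : Witt.coeffIdeal I' ≤ RingHom.ker φ.hom.toRingHom ↔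
      I' ≤ RingHom.ker (Witt.map (n := n) (R.baseHom n φ.hom)).toRingHom :=
    Witt.coeffIdeal_le_ker_iff I' (R.baseHom n φ.hom)
  have h2 : I ≤ RingHom.ker ((R.wittFunctor n).map φ).hom.toRingHom ↔
      I' ≤ RingHom.ker (Witt.map (n := n) (R.baseHom n φ.hom)).toRingHom := by
    -- The `R_0`-algebra structures do not affect the underlying ring map `W_n(φ)`, nor its kernel.
    rfl
  rw [h1, ← h2]
  exact hI _ ((R.wittFunctor n).map φ)

end PiJet

end

theorem lemma3p4 {O : Type v} [CommRing O] [IsDedekindDomain O] (π : O) [Fact (Prime π)]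
    [Finite (O ⧸ Ideal.span {π})] (R : PiJet.ProlongationSequence.{u} π) (n : ℕ)
    {X Y : Over (Spec (CommRingCat.of (R.C 0)))} (f : X ⟶ Y) [IsClosedImmersion f.left] :
    PiJet.IsSheafClosedImmersion ((R.jet n).map ((PiJet.points (R.C 0)).map f)) := by
  exact (R.liftsAreClosed_jet n (PiJet.liftsAreClosed_points f)).isSheafClosedImmersion
    -- The component of `J^n f` at `B` is that of `f` at `W_n(B)`, hence injective.
    fun _ ↦ PiJet.injective_points_map f _
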